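/- **Definitions.** A *de Vries algebra* is a pair $(A,\prec)$ of a complete Boolean algebra $A$ and a binary relation $\prec$ on $A$ such that: $1\prec 1$; $a\prec b$ implies $a\le b$; $a\le b\prec c\le d$ implies $a\prec d$; $a\prec b$ and $a\prec c$ imply $a\prec b\wedge c$; $a\prec b$ implies $\neg b\prec\neg a$; $a\prec b$ implies $a\prec c\prec b$ for some $c$; and $b\neq 0$ implies $a\prec b$ for some $a\neq 0$. A *de Vries morphism* is a map $\rho$ between de Vries algebras with $\rho(0)=0$, $\rho(a\wedge b)=\rho(a)\wedge\rho(b)$, $\neg\rho(\neg a)\prec\rho(b)$ whenever $a\prec b$, and $\rho(b)=\bigvee\{\rho(a)\mid a\prec b\}$. De Vries algebras and de Vries morphisms form a category $\mathsf{DeV}$ with composition $(\rho_2\star\rho_1)(b)=\bigvee\{\rho_2\rho_1(a)\mid a\prec b\}$. Let $\mathsf{CABA}$ be the category of complete and atomic Boolean algebras and complete Boolean homomorphisms; each $B\in\mathsf{CABA}$ is regarded as the de Vries algebra $(B,\le)$. A *de Vries extension* is an injective de Vries morphism $\alpha:A\to B$ from a de Vries algebra $A$ to some $B=(B,\le)$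 with $B\in\mathsf{CABA}$, such that each element of $B$ is a join of meets of elements of $\alpha[A]$. A morphism from $\alpha:A\to B$ to $\alpha':A'\to B'$ is a pair $(\rho,\sigma)$ of a de Vries morphism $\rho:A\to A'$ and a complete Boolean homomorphism $\sigma:B\to B'$ with $\sigma\circ\alpha=\alpha'\star\rho$; composition is $(\rho_2,\sigma_2)(\rho_1,\sigma_1)=(\rho_2\star\rho_1,\sigma_2\circ\sigma_1)$. The extension $\alpha$ is *maximal* if for every de Vries extension $\gamma:C\to B$ with $\gamma[C]=\alpha[A]$ there is a de Vries morphism $\delta:C\to A$ with $\alpha\star\delta=\gamma$. Let $\mathsf{MDeVe}$ be the full subcategory of maximal de Vries extensions, in the category of de Vries extensions. Let $\mathsf{CReg}$ be the category of completely regular (Hausdorff) spaces and continuous maps, and $\mathsf{KHaus}$ that of compact Hausdorff spaces. For $Y\in\mathsf{KHaus}$ let $Y^*=(\mathcal{RO}(Y),\prec)$ be the complete Boolean algebra of regular open subsets of $Y$, with $U\prec V$ iff $\mathrm{cl}(U)\subseteq V$; for a continuous $g:Y\to Z$ let $g^*(U)=\mathrm{int}(\mathrm{cl}(g^{-1}(U)))$.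 This gives a functor $(-)^*:\mathsf{KHaus}^{op}\to\mathsf{DeV}$. Let $\wp:\mathsf{Set}^{op}\to\mathsf{CABA}$ be the functor $X\mapsto\wp(X)$, $f\mapsto f^{-1}$. **Theorem.** $\mathsf{CReg}$ is dually equivalent to $\mathsf{MDeVe}$, by an equivalence that extends de Vries duality and Tarski duality. Precisely, there is an equivalence of categories $F:\mathsf{CReg}^{op}\to\mathsf{MDeVe}$ with the following properties. 1. Up to natural isomorphisms of the two components that commute with the extensions, $F$ sends $X$ to $s^{-1}:\mathcal{RO}(\beta X)\to\wp(X)$, where $s:X\to\beta X$ is the Stone–Čech compactification, and sends $f$ to $((\beta f)^*,f^{-1})$. 2. The functor $(-)^*$ is an equivalence, and there is a full and faithful functor $J:\mathsf{DeV}\to\mathsf{MDeVe}$ such that the domain of the extension $J(A)$ is naturally isomorphic to $A$ and such that the restriction of $F$ to compact Hausdorff spaces is naturally isomorphic to $J\circ(-)^*$. 3. The functor $\wp$ is an equivalence, the functor $I:\mathsf{CABA}\to\mathsf{MDeVe}$ that sends $B$ to $\mathrm{id}:(B,\le)\to(B,\le)$ and $\sigma$ to $(\sigma,\sigma)$ is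 full and faithful, and the restriction of $F$ to discrete spaces is naturally isomorphic to $I\circ\wp$. -/

import Mathlib

open CategoryTheory Opposite TopologicalSpace

universe u

/-! ## De Vries algebras -/

/-- A de Vries proximity on a Boolean algebra. -/
structure IsDeVriesProximity {A : Type u} [BooleanAlgebra A] (r : A → A → Prop) : Prop where
  dv1 : r ⊤ ⊤
  dv2 : ∀ a b, r a b → a ≤ b
  dv3 : ∀ a b c d, a ≤ b → r b c → c ≤ d → r a d
  dv4 : ∀ a b c, r a b → r a c → r a (b ⊓ c)
  dv5 : ∀ a b, r a b → r bᶜ aᶜ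
  dv6 : ∀ a b, r a b → ∃ c, r a c ∧ r c b
  dv7 : ∀ b, b ≠ ⊥ → ∃ a, a ≠ ⊥ ∧ r a b

/-- A de Vries algebra: a complete Boolean algebra with a de Vries proximity `prec`. -/
structure DeV : Type (u + 1) where
  carrier : Type u
  [str : CompleteBooleanAlgebra carrier]
  prec : carrier → carrier → Prop
  isProx : IsDeVriesProximity prec

namespace DeV

instance : CoeSort DeV.{u} (Type u) := ⟨DeV.carrier⟩

instance (A : DeV.{u}) : CompleteBooleanAlgebra A := A.str

/-- A de Vries morphism. -/
@[ext]
structure Hom (A B : DeV.{u}) : Type u where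
  toFun : A → B
  map_bot : toFun ⊥ = ⊥
  map_inf : ∀ a b, toFun (a ⊓ b) = toFun a ⊓ toFun b
  map_prec : ∀ a b, A.prec a b → B.prec (toFun aᶜ)ᶜ (toFun b)
  map_approx : ∀ b, toFun b = sSup {y | ∃ a, A.prec a b ∧ y = toFun a}

theorem bot_prec_bot (A : DeV.{u}) : A.prec ⊥ ⊥ := by
  have h := A.isProx.dv5 _ _ A.isProx.dv1
  rwa [compl_top] at h

theorem sSup_prec (A : DeV.{u}) (b : A) : b = sSup {y | ∃ a, A.prec a b ∧ y = a} := by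
  set s : A := sSup {y | ∃ a, A.prec a b ∧ y = a} with hs
  have hle : s ≤ b := sSup_le (by rintro _ ⟨a, ha, rfl⟩; exact A.isProx.dv2 _ _ ha)
  refine le_antisymm ?_ hle
  by_contra hn
  have hne : b ⊓ sᶜ ≠ ⊥ := fun h => hn (by rwa [← sdiff_eq, sdiff_eq_bot_iff] at h)
  obtain ⟨a, ha0, ha⟩ := A.isProx.dv7 _ hne
  have h1 : a ≤ s := le_sSup ⟨a, A.isProx.dv3 _ _ _ _ le_rfl ha inf_le_left, rfl⟩
  have h2 : a ≤ sᶜ := (A.isProx.dv2 _ _ ha).trans inf_le_right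
  exact ha0 (le_bot_iff.1 ((le_inf h1 h2).trans (inf_compl_self s).le))

namespace Hom

variable {A B C D : DeV.{u}}

theorem mono (f : Hom A B) {a b : A} (h : a ≤ b) : f.toFun a ≤ f.toFun b := by
  have := f.map_inf a b
  rw [inf_eq_left.2 h] at this
  rw [this]; exact inf_le_right

theorem toFun_le_compl (f : Hom A B) (a : A) : f.toFun a ≤ (f.toFun aᶜ)ᶜ := by
  rw [le_compl_iff_disjoint_right, disjoint_iff, ← f.map_inf, inf_compl_self, f.map_bot]

theorem prec_of_prec (f : Hom A B) {a b : A} (h : A.prec a b) :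
    B.prec (f.toFun a) (f.toFun b) :=
  B.isProx.dv3 _ _ _ _ (f.toFun_le_compl a) (f.map_prec a b h) le_rfl

/-- The underlying map of the composite `g ⋆ f` (first `f`, then `g`) of de Vries morphisms. -/
def starFun (g : Hom B C) (f : Hom A B) (b : A) : C :=
  sSup {y | ∃ a, A.prec a b ∧ y = g.toFun (f.toFun a)}

theorem le_starFun (g : Hom B C) (f : Hom A B) {a b : A} (h : A.prec a b) :
    g.toFun (f.toFun a) ≤ starFun g f b := le_sSup ⟨a, h, rfl⟩

theorem starFun_le (g : Hom B C) (f : Hom A B) {b : A} {c : C}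
    (h : ∀ a, A.prec a b → g.toFun (f.toFun a) ≤ c) : starFun g f b ≤ c :=
  sSup_le (by rintro _ ⟨a, ha, rfl⟩; exact h a ha)

theorem starFun_le_apply (g : Hom B C) (f : Hom A B) (b : A) :
    starFun g f b ≤ g.toFun (f.toFun b) :=
  starFun_le g f fun _ ha => g.mono (f.mono (A.isProx.dv2 _ _ ha))

theorem starFun_mono (g : Hom B C) (f : Hom A B) {b c : A} (h : b ≤ c) :
    starFun g f b ≤ starFun g f c :=
  starFun_le g f fun _ ha => le_starFun g f (A.isProx.dv3 _ _ _ _ le_rfl ha h)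

/-- The composite `g ⋆ f` of de Vries morphisms:
`(g ⋆ f) b` is the join of all `g (f a)` with `a ≺ b`. -/
def star (g : Hom B C) (f : Hom A B) : Hom A C where
  toFun := starFun g f
  map_bot := le_bot_iff.1 <| (starFun_le_apply g f ⊥).trans (by rw [f.map_bot, g.map_bot])
  map_inf a b := by
    refine le_antisymm
      (le_inf (starFun_mono g f inf_le_left) (starFun_mono g f inf_le_right)) ?_
    unfold starFun
    rw [sSup_inf_sSup]
    refine iSup₂_le ?_
    rintro ⟨_, _⟩ ⟨⟨x, hx, rfl⟩, ⟨y, hy, rfl⟩⟩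
    refine le_sSup ⟨x ⊓ y, ?_, ?_⟩
    · exact A.isProx.dv4 _ _ _ (A.isProx.dv3 _ _ _ _ inf_le_left hx le_rfl)
        (A.isProx.dv3 _ _ _ _ inf_le_right hy le_rfl)
    · simp only [f.map_inf, g.map_inf]
  map_prec a b h := by
    obtain ⟨c, hac, hcb⟩ := A.isProx.dv6 _ _ h
    obtain ⟨d, hcd, hdb⟩ := A.isProx.dv6 _ _ hcb
    have h1 := g.map_prec _ _ (f.map_prec c d hcd)
    rw [compl_compl] at h1
    exact C.isProx.dv3 _ _ _ _ (compl_le_compl (le_starFun g f (A.isProx.dv5 _ _ hac))) h1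
      (le_starFun g f hdb)
  map_approx b := by
    refine le_antisymm (starFun_le g f fun a ha => ?_) (sSup_le ?_)
    · obtain ⟨c, hac, hcb⟩ := A.isProx.dv6 _ _ ha
      exact (le_starFun g f hac).trans (le_sSup ⟨c, hcb, rfl⟩)
    · rintro _ ⟨a, ha, rfl⟩
      exact starFun_mono g f (A.isProx.dv2 _ _ ha)

/-- The identity map as a de Vries morphism. -/
def id (A : DeV.{u}) : Hom A A where
  toFun := fun a => a
  map_bot := rfl
  map_inf _ _ := rfl
  map_prec a b h := by rwa [compl_compl]
  map_approx b := A.sSup_prec b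

theorem id_star (f : Hom A B) : star (id B) f = f := by
  ext b; exact (f.map_approx b).symm

theorem star_id (f : Hom A B) : star f (id A) = f := by
  ext b; exact (f.map_approx b).symm

theorem star_assoc (h : Hom C D) (g : Hom B C) (f : Hom A B) :
    star h (star g f) = star (star h g) f := by
  ext b
  refine le_antisymm (starFun_le _ _ fun a ha => ?_) (starFun_le _ _ fun a ha => ?_)
  · obtain ⟨c, hac, hcb⟩ := A.isProx.dv6 _ _ ha
    refine (h.mono (starFun_le_apply g f a)).trans ?_
    exact (le_starFun h g (f.prec_of_prec hac)).trans (le_starFun (star h g) f hcb)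
  · obtain ⟨c, hac, hcb⟩ := A.isProx.dv6 _ _ ha
    refine (starFun_le_apply h g _).trans ?_
    exact (h.mono (le_starFun g f hac)).trans (le_starFun h (star g f) hcb)

end Hom

/-- The category of de Vries algebras and de Vries morphisms, with composition `⋆`. -/
instance : Category DeV.{u} where
  Hom := Hom
  id := Hom.id
  comp f g := Hom.star g f
  id_comp := Hom.star_id
  comp_id := Hom.id_star
  assoc f g h := Hom.star_assoc h g f

/-- The map underlying a morphism of `DeV`. -/
abbrev fn {A B : DeV.{u}} (f : A ⟶ B) : A → B := Hom.toFun f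

end DeV

/-! ## Complete and atomic Boolean algebras -/

/-- A complete and atomic Boolean algebra. -/
structure CABA : Type (u + 1) where
  carrier : Type u
  [str : CompleteBooleanAlgebra carrier]
  [atomic : IsAtomic carrier]

namespace CABA

instance : CoeSort CABA.{u} (Type u) := ⟨CABA.carrier⟩

instance (B : CABA.{u}) : CompleteBooleanAlgebra B := B.str

instance (B : CABA.{u}) : IsAtomic B := B.atomic

/-- The category of complete and atomic Boolean algebras and complete Boolean homomorphisms
(maps preserving arbitrary joins and meets, hence also complements). -/
instance : Category CABA.{u} where
  Hom B C := CompleteLatticeHom B C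
  id B := CompleteLatticeHom.id B
  comp f g := CompleteLatticeHom.comp g f

/-- The map underlying a morphism of `CABA`. -/
abbrev fn {B C : CABA.{u}} (σ : B ⟶ C) : B → C := (show CompleteLatticeHom B C from σ)

theorem isDeVriesProximity_le (B : Type u) [BooleanAlgebra B] :
    IsDeVriesProximity (fun a b : B => a ≤ b) where
  dv1 := le_rfl
  dv2 _ _ h := h
  dv3 _ _ _ _ h1 h2 h3 := (h1.trans h2).trans h3
  dv4 _ _ _ := le_inf
  dv5 _ _ h := compl_le_compl h
  dv6 a _ h := ⟨a, le_rfl, h⟩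
  dv7 b hb := ⟨b, hb, le_rfl⟩

/-- The atomic extremally disconnected de Vries algebra `(B, ≤)`. -/
def toDeV (B : CABA.{u}) : DeV.{u} where
  carrier := B
  prec a b := a ≤ b
  isProx := isDeVriesProximity_le B

end CABA

/-! ## De Vries extensions -/

/-- `α[A]` is join-meet dense in `B`: each element of `B` is a join of meets from `α[A]`. -/
def JoinMeetDense {A B : DeV.{u}} (α : A ⟶ B) : Prop :=
  ∀ b : B, ∃ S : Set B, (∀ s ∈ S, ∃ M : Set B, M ⊆ Set.range (DeV.fn α) ∧ s = sInf M) ∧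
    b = sSup S

/-- A de Vries extension `α : A → B`. -/
structure IsDeVriesExtension {A : DeV.{u}} {B : CABA.{u}} (α : A ⟶ B.toDeV) : Prop where
  injective : Function.Injective (DeV.fn α)
  dense : JoinMeetDense α

/-- The type of de Vries extensions. -/
structure DeVe : Type (u + 1) where
  base : DeV.{u}
  top : CABA.{u}
  map : base ⟶ top.toDeV
  isExt : IsDeVriesExtension map

namespace DeVe

/-- The map underlying a de Vries extension. -/
abbrev fn (E : DeVe.{u}) : E.base → E.top := DeV.fn E.map

/-- A morphism of de Vries extensions: a pair `(ρ, σ)` of a de Vries morphism and a complete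
Boolean homomorphism with `σ ∘ α = α' ⋆ ρ`. -/
@[ext]
structure Hom (E E' : DeVe.{u}) : Type u where
  ρ : E.base ⟶ E'.base
  σ : E.top ⟶ E'.top
  comm : ∀ a, CABA.fn σ (E.fn a) = DeV.fn (ρ ≫ E'.map) a

/-- A complete Boolean homomorphism may be moved inside a star composite. -/
theorem comp_eq {E₁ E₂ E₃ : DeVe.{u}} (f : Hom E₁ E₂) (g : Hom E₂ E₃) (a : E₁.base) :
    CABA.fn (f.σ ≫ g.σ) (E₁.fn a) = DeV.fn ((f.ρ ≫ g.ρ) ≫ E₃.map) a := by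
  rw [Category.assoc]
  change CABA.fn g.σ (CABA.fn f.σ (E₁.fn a)) = _
  rw [f.comm a]
  have key : ∀ S : Set E₂.top, CABA.fn g.σ (sSup S) = sSup (CABA.fn g.σ '' S) :=
    fun S => map_sSup (show CompleteLatticeHom E₂.top E₃.top from g.σ) S
  refine (key _).trans ?_
  refine le_antisymm (sSup_le ?_) (sSup_le ?_)
  · rintro _ ⟨_, ⟨x, hx, rfl⟩, rfl⟩
    exact le_sSup ⟨x, hx, g.comm _⟩
  · rintro _ ⟨x, hx, rfl⟩
    exact le_sSup ⟨_, ⟨x, hx, rfl⟩, g.comm _⟩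

/-- The category of de Vries extensions; morphisms are composed componentwise,
by `⋆` and by `∘`. -/
instance : Category DeVe.{u} where
  Hom := Hom
  id E := { ρ := 𝟙 _, σ := 𝟙 _, comm := fun a => by rw [Category.id_comp]; rfl }
  comp f g := { ρ := f.ρ ≫ g.ρ, σ := f.σ ≫ g.σ, comm := comp_eq f g }
  id_comp f := Hom.ext (Category.id_comp f.ρ) (Category.id_comp f.σ)
  comp_id f := Hom.ext (Category.comp_id f.ρ) (Category.comp_id f.σ)
  assoc f g h := Hom.ext (Category.assoc f.ρ g.ρ h.ρ) (Category.assoc f.σ g.σ h.σ)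

/-- The functor sending `α : A → B` to `A`. -/
def baseFunctor : DeVe.{u} ⥤ DeV.{u} where
  obj E := E.base
  map f := Hom.ρ f

/-- The functor sending `α : A → B` to `B`. -/
def topFunctor : DeVe.{u} ⥤ CABA.{u} where
  obj E := E.top
  map f := Hom.σ f

/-- A de Vries extension `α : A → B` is maximal if every compatible extension `γ : C → B`
(that is, one with `γ[C] = α[A]`) has the form `γ = α ⋆ δ` for a de Vries morphism `δ : C → A`. -/
def IsMaximal : ObjectProperty DeVe.{u} := fun E =>
  ∀ (C : DeV.{u}) (γ : C ⟶ E.top.toDeV), IsDeVriesExtension γ →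
    Set.range (DeV.fn E.map) = Set.range (DeV.fn γ) → ∃ δ : C ⟶ E.base, δ ≫ E.map = γ

end DeVe

/-- The full subcategory of maximal de Vries extensions. -/
abbrev MDeVe : Type (u + 1) := DeVe.IsMaximal.{u}.FullSubcategory

/-! ## Completely regular spaces -/

/-- The category of completely regular (Hausdorff) spaces and continuous maps. -/
abbrev CReg : Type (u + 1) :=
  ObjectProperty.FullSubcategory (fun X : TopCat.{u} => T35Space X)

namespace CReg

/-- The Stone–Čech compactification functor on completely regular spaces. -/
noncomputable def beta : CReg.{u} ⥤ CompHaus.{u} := ObjectProperty.ι _ ⋙ topToCompHaus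

/-- The canonical map `s : X → βX`. -/
def s (X : CReg.{u}) : X.obj → beta.obj X := (stoneCechUnit : X.obj → StoneCech X.obj)

/-- The underlying-set functor. -/
def points : CReg.{u} ⥤ Type u := ObjectProperty.ι _ ⋙ forget TopCat.{u}

theorem t35Space_of_compact (X : Type u) [TopologicalSpace X] [CompactSpace X] [T2Space X] :
    T35Space X := inferInstance

theorem t35Space_of_discrete (X : Type u) [TopologicalSpace X] [DiscreteTopology X] :
    T35Space X := inferInstance

/-- The inclusion of compact Hausdorff spaces. -/
def ofCompHaus : CompHaus.{u} ⥤ CReg.{u} :=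
  ObjectProperty.lift _ compHausToTop fun X =>
    t35Space_of_compact X

/-- Sets as discrete spaces. -/
def ofSet : Type u ⥤ CReg.{u} :=
  ObjectProperty.lift _ TopCat.discrete fun X =>
    have : DiscreteTopology (TopCat.discrete.obj X) := ⟨rfl⟩
    t35Space_of_discrete _

end CReg

/-! ## Regular open sets and the functors of de Vries and Tarski duality -/

/-- The regular open subsets of `X`: the open sets `U` with `Uᶜᶜ = U`, where `Uᶜ` is the
pseudocomplement (the interior of the set complement) of `U` in the lattice of open sets. -/
abbrev RegularOpen (X : Type u) [TopologicalSpace X] : Type u := Heyting.Regular (Opens X)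

namespace RegularOpen

open Heyting.Regular

variable {X Y : Type u} [TopologicalSpace X] [TopologicalSpace Y]

theorem coe_compl_opens (U : Opens X) : ((Uᶜ : Opens X) : Set X) = interior ((U : Set X)ᶜ) := by
  ext x
  constructor
  · intro hx
    refine mem_interior.2 ⟨_, ?_, (Uᶜ).isOpen, hx⟩
    intro y hy hyU
    exact (disjoint_compl_left (a := U)).le_bot (⟨hy, hyU⟩ : y ∈ (Uᶜ ⊓ U : Opens X))
  · intro hx
    have : (⟨interior ((U : Set X)ᶜ), isOpen_interior⟩ : Opens X) ≤ Uᶜ := by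
      rw [le_compl_iff_disjoint_right, disjoint_iff_inf_le]
      rintro y ⟨hy, hyU⟩
      exact (interior_subset hy hyU).elim
    exact this hx

theorem coe_compl_compl (U : Opens X) :
    ((Uᶜᶜ : Opens X) : Set X) = interior (closure (U : Set X)) := by
  rw [coe_compl_opens, coe_compl_opens, ← closure_compl, compl_compl]

/-- `Heyting.Regular (Opens X)` consists of the open sets with `int (cl U) = U`. -/
theorem isRegular_iff (U : Opens X) :
    Heyting.IsRegular U ↔ interior (closure (U : Set X)) = U := by
  rw [← coe_compl_compl, SetLike.coe_set_eq]; rfl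

/-- The complete Boolean algebra of regular open sets: the join of a family is `int (cl (⋃ U))`
and the meet is the interior of the intersection. -/
instance : CompleteBooleanAlgebra (RegularOpen X) :=
  { (inferInstance : BooleanAlgebra (RegularOpen X)) with
    sSup := fun S => toRegular (sSup (Heyting.Regular.val '' S))
    sInf := fun S => toRegular (sInf (Heyting.Regular.val '' S))
    isLUB_sSup := fun S => ⟨fun U hU => by
        rw [← coe_le_coe]
        exact (le_sSup (Set.mem_image_of_mem _ hU)).trans le_compl_compl,
      fun V hV => by
        rw [← toRegular_coe V]
        exact toRegular.monotone (sSup_le (by rintro _ ⟨U, hU, rfl⟩; exact hV hU))⟩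
    isGLB_sInf := fun S => ⟨fun U hU => by
        rw [← toRegular_coe U]
        exact toRegular.monotone (sInf_le (Set.mem_image_of_mem _ hU)),
      fun V hV => by
        rw [← toRegular_coe V]
        exact toRegular.monotone (le_sInf (by rintro _ ⟨U, hU, rfl⟩; exact hV hU))⟩ }

/-- The set of points of a regular open set. -/
abbrev pts (U : RegularOpen X) : Set X := (U.val : Set X)

theorem pts_le {U V : RegularOpen X} : U ≤ V ↔ U.pts ⊆ V.pts := Iff.rfl

theorem isOpen_pts (U : RegularOpen X) : IsOpen U.pts := U.val.isOpen

theorem pts_compl (U : RegularOpen X) : (Uᶜ).pts = interior (U.pts)ᶜ := coe_compl_opens _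

theorem pts_bot : (⊥ : RegularOpen X).pts = ∅ := rfl

theorem interior_closure_pts (U : RegularOpen X) : interior (closure U.pts) = U.pts :=
  (isRegular_iff _).1 U.prop

/-- The regularization `int (cl S)` of an open set. -/
def reg (S : Set X) (h : IsOpen S) : RegularOpen X := toRegular ⟨S, h⟩

theorem pts_reg (S : Set X) (h : IsOpen S) : (reg S h).pts = interior (closure S) :=
  coe_compl_compl _

theorem subset_reg (S : Set X) (h : IsOpen S) : S ⊆ (reg S h).pts := by
  rw [pts_reg]; exact interior_maximal subset_closure h

theorem reg_le {S : Set X} {h : IsOpen S} {U : RegularOpen X} (hS : S ⊆ U.pts) :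
    reg S h ≤ U := by
  rw [pts_le, pts_reg, ← interior_closure_pts U]
  exact interior_mono (closure_mono hS)

/-- The canonical proximity: `U ≺ V` iff `cl U ⊆ V`. -/
def Prec (U V : RegularOpen X) : Prop := closure U.pts ⊆ V.pts

theorem exists_prec [CompactSpace X] [T2Space X] (V : RegularOpen X) {x : X} (hx : x ∈ V.pts) :
    ∃ U : RegularOpen X, x ∈ U.pts ∧ Prec U V := by
  obtain ⟨F, hF, hFc, hFV⟩ := exists_mem_nhds_isClosed_subset (V.isOpen_pts.mem_nhds hx)
  refine ⟨reg (interior F) isOpen_interior,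
    subset_reg _ _ (mem_interior_iff_mem_nhds.2 hF), ?_⟩
  refine (closure_minimal ?_ hFc).trans hFV
  rw [pts_reg]
  exact interior_subset.trans (closure_minimal interior_subset hFc)

theorem isDeVriesProximity_prec [CompactSpace X] [T2Space X] :
    IsDeVriesProximity (Prec : RegularOpen X → RegularOpen X → Prop) where
  dv1 := Set.subset_univ _
  dv2 _ _ h := subset_closure.trans h
  dv3 _ _ _ _ h1 h2 h3 := (closure_mono h1).trans (h2.trans h3)
  dv4 _ _ _ h1 h2 := Set.subset_inter h1 h2
  dv5 U V h := by
    change closure (Vᶜ).pts ⊆ (Uᶜ).pts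
    rw [pts_compl, pts_compl, interior_compl, interior_compl, closure_compl,
      Set.compl_subset_compl]
    exact h.trans (interior_maximal subset_closure V.isOpen_pts)
  dv6 U V h := by
    obtain ⟨W, hWo, hUW, hWV⟩ := normal_exists_closure_subset isClosed_closure V.isOpen_pts h
    refine ⟨reg W hWo, hUW.trans (subset_reg _ _), (closure_minimal ?_ isClosed_closure).trans hWV⟩
    rw [pts_reg]; exact interior_subset
  dv7 V hV := by
    have : V.pts.Nonempty := by
      rw [Set.nonempty_iff_ne_empty]
      intro h0
      exact hV (le_bot_iff.1 (pts_le.2 (by rw [h0]; exact Set.empty_subset _)))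
    obtain ⟨x, hx⟩ := this
    obtain ⟨U, hxU, hUV⟩ := exists_prec V hx
    refine ⟨U, ?_, hUV⟩
    rintro rfl
    exact hxU

/-- The map `f^*(U) = int (cl (f⁻¹ U))` on regular open sets. -/
def pullback (f : X → Y) (hf : Continuous f) (U : RegularOpen Y) : RegularOpen X :=
  reg (f ⁻¹' U.pts) (U.isOpen_pts.preimage hf)

theorem pts_pullback (f : X → Y) (hf : Continuous f) (U : RegularOpen Y) :
    (pullback f hf U).pts = interior (closure (f ⁻¹' U.pts)) := pts_reg _ _

theorem pts_pullback_subset (f : X → Y) (hf : Continuous f) {U V : RegularOpen Y}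
    (h : Prec U V) : (pullback f hf U).pts ⊆ f ⁻¹' V.pts := by
  rw [pts_pullback]
  refine interior_subset.trans ((closure_minimal ?_ (isClosed_closure.preimage hf)).trans
    (Set.preimage_mono h))
  exact Set.preimage_mono subset_closure

theorem pullback_mono (f : X → Y) (hf : Continuous f) {U V : RegularOpen Y} (h : U ≤ V) :
    pullback f hf U ≤ pullback f hf V :=
  reg_le ((Set.preimage_mono (pts_le.1 h)).trans (subset_reg _ _))

/-- If `f⁻¹ U ⊆ T U` for all `U`, then `f^*(V)` is at most the join of all `T U` with `U ≺ V`. -/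
theorem pullback_le_sSup [CompactSpace Y] [T2Space Y] (f : X → Y) (hf : Continuous f)
    (V : RegularOpen Y) (T : RegularOpen Y → RegularOpen X) (hT : ∀ U, f ⁻¹' U.pts ⊆ (T U).pts) :
    pullback f hf V ≤ sSup {W | ∃ U, Prec U V ∧ W = T U} := by
  refine reg_le fun x hx => ?_
  obtain ⟨U, hxU, hUV⟩ := exists_prec V (show f x ∈ V.pts from hx)
  have hle : T U ≤ sSup {W | ∃ U, Prec U V ∧ W = T U} := le_sSup ⟨U, hUV, rfl⟩
  exact pts_le.1 hle (hT U hxU)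

theorem pullback_bot (f : X → Y) (hf : Continuous f) : pullback f hf ⊥ = ⊥ :=
  le_bot_iff.1 (reg_le (U := ⊥) (Set.Subset.refl (∅ : Set X)))

theorem pullback_inf (f : X → Y) (hf : Continuous f) (U V : RegularOpen Y) :
    pullback f hf (U ⊓ V) = pullback f hf U ⊓ pullback f hf V :=
  coe_injective (compl_compl_inf_distrib (⟨f ⁻¹' U.pts, U.isOpen_pts.preimage hf⟩ : Opens X)
    (⟨f ⁻¹' V.pts, V.isOpen_pts.preimage hf⟩ : Opens X))

theorem pullback_prec (f : X → Y) (hf : Continuous f) (U V : RegularOpen Y) (h : Prec U V) :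
    Prec (pullback f hf Uᶜ)ᶜ (pullback f hf V) := by
  refine Set.Subset.trans (closure_minimal ?_ (isClosed_closure.preimage hf))
    ((Set.preimage_mono h).trans (subset_reg _ (V.isOpen_pts.preimage hf)))
  rw [pts_compl]
  refine interior_subset.trans ?_
  rw [Set.compl_subset_comm, ← Set.preimage_compl, ← interior_compl, ← pts_compl]
  exact subset_reg _ _

theorem pullback_approx [CompactSpace Y] [T2Space Y] (f : X → Y) (hf : Continuous f)
    (V : RegularOpen Y) :
    pullback f hf V = sSup {W | ∃ U, Prec U V ∧ W = pullback f hf U} := by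
  refine le_antisymm (pullback_le_sSup f hf V _ fun U => subset_reg _ _) (sSup_le ?_)
  rintro _ ⟨U, hU, rfl⟩
  exact pullback_mono f hf (subset_closure.trans hU)

theorem pullback_id (U : RegularOpen X) : pullback (fun x => x) continuous_id U = U :=
  toRegular_coe U

theorem pullback_comp {Z : Type u} [TopologicalSpace Z] [CompactSpace Z] [T2Space Z]
    (f : X → Y) (hf : Continuous f) (g : Y → Z) (hg : Continuous g) (V : RegularOpen Z) :
    pullback (fun x => g (f x)) (hg.comp hf) V =
      sSup {W | ∃ U, Prec U V ∧ W = pullback f hf (pullback g hg U)} := by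
  refine le_antisymm (pullback_le_sSup _ _ V (fun U => pullback f hf (pullback g hg U))
    fun U x hx => ?_) (sSup_le ?_)
  · exact subset_reg _ _ (subset_reg (g ⁻¹' U.pts) (U.isOpen_pts.preimage hg) hx)
  · rintro _ ⟨U, hU, rfl⟩
    refine reg_le (Set.Subset.trans ?_ (subset_reg _ _))
    exact Set.preimage_mono (f := f) (pts_pullback_subset g hg hU)

end RegularOpen

namespace CompHaus

/-- The de Vries algebra `(RO(Y), ≺)` of a compact Hausdorff space. -/
def regularOpens (Y : CompHaus.{u}) : DeV.{u} where
  carrier := RegularOpen Y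
  prec := RegularOpen.Prec
  isProx := RegularOpen.isDeVriesProximity_prec

/-- The de Vries morphism `f^* : RO(Y) → RO(X)`, `f^*(U) = int (cl (f⁻¹ U))`, of a continuous
map `f : X → Y`. -/
def pullback {X Y : CompHaus.{u}} (f : X ⟶ Y) : DeV.Hom Y.regularOpens X.regularOpens where
  toFun := RegularOpen.pullback f f.hom.hom.continuous
  map_bot := RegularOpen.pullback_bot _ _
  map_inf := RegularOpen.pullback_inf _ _
  map_prec := RegularOpen.pullback_prec _ _
  map_approx := RegularOpen.pullback_approx _ _

end CompHaus

/-- The contravariant functor `(-)^*` of de Vries duality. -/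
def deVriesDual : CompHaus.{u}ᵒᵖ ⥤ DeV.{u} where
  obj Y := Y.unop.regularOpens
  map f := CompHaus.pullback f.unop
  map_id _ := DeV.Hom.ext (funext RegularOpen.pullback_id)
  map_comp f g := DeV.Hom.ext (funext (RegularOpen.pullback_comp
    g.unop g.unop.hom.hom.continuous f.unop f.unop.hom.hom.continuous))

/-- The contravariant functor of Tarski duality: `X ↦ ℘(X)` and `f ↦ f⁻¹`. -/
def tarskiDual : (Type u)ᵒᵖ ⥤ CABA.{u} where
  obj X := { carrier := Set X.unop }
  map f := CompleteLatticeHom.setPreimage f.unop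

/-! ## Complete atomic Boolean algebras as maximal de Vries extensions -/

/-- The identity `(B, ≤) → (B, ≤)`, as a maximal de Vries extension. -/
def CABA.idExtension (B : CABA.{u}) : MDeVe.{u} where
  obj :=
    { base := B.toDeV
      top := B
      map := 𝟙 _
      isExt :=
        ⟨fun _ _ h => h, fun b => ⟨{b}, fun s _ => ⟨{s}, fun x _ => ⟨x, rfl⟩, sInf_singleton.symm⟩,
          sSup_singleton.symm⟩⟩ }
  property := fun _ γ _ _ => ⟨γ, Category.comp_id γ⟩

section

variable {B C : Type u} [CompleteBooleanAlgebra B] [CompleteBooleanAlgebra C]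
  (σ : CompleteLatticeHom B C)

theorem CABA.map_bot_of : σ ⊥ = ⊥ := map_bot σ

theorem CABA.map_inf_of (a b : B) : σ (a ⊓ b) = σ a ⊓ σ b := map_inf σ a b

theorem CABA.map_prec_of (a b : B) (h : a ≤ b) : (σ aᶜ)ᶜ ≤ σ b := by
  rw [map_compl' σ, compl_compl]
  exact OrderHomClass.mono σ h

theorem CABA.map_approx_of (b : B) : σ b = sSup {y | ∃ a, a ≤ b ∧ y = σ a} :=
  le_antisymm (le_sSup ⟨b, le_rfl, rfl⟩) (sSup_le (by
    rintro _ ⟨a, ha, rfl⟩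
    exact OrderHomClass.mono σ ha))

end

/-- A complete Boolean homomorphism, as a de Vries morphism `(B, ≤) → (C, ≤)`. -/
def CABA.homToDeV {B C : CABA.{u}} (σ : B ⟶ C) : DeV.Hom B.toDeV C.toDeV :=
  { toFun := CABA.fn σ
    map_bot := CABA.map_bot_of (B := B) (C := C) σ
    map_inf := CABA.map_inf_of (B := B) (C := C) σ
    map_prec := CABA.map_prec_of (B := B) (C := C) σ
    map_approx := CABA.map_approx_of (B := B) (C := C) σ }

/-- The functor that sends `B` to the identity of `(B, ≤)` and `σ` to `(σ, σ)`. -/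
def CABA.toMDeVe : CABA.{u} ⥤ MDeVe.{u} where
  obj := CABA.idExtension
  map {B C} σ := ObjectProperty.homMk
    { ρ := CABA.homToDeV σ
      σ := σ
      comm := fun b => congrArg (fun h => DeV.Hom.toFun h b)
        (Category.comp_id (show B.toDeV ⟶ C.toDeV from CABA.homToDeV σ)).symm }
  map_id _ := ObjectProperty.hom_ext _ (DeVe.Hom.ext rfl rfl)
  map_comp {B C D} σ τ := ObjectProperty.hom_ext _ (DeVe.Hom.ext (DeV.Hom.ext (funext fun b =>
    le_antisymm (le_sSup ⟨b, le_refl (α := B) b, rfl⟩) (sSup_le (by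
      rintro _ ⟨a, ha, rfl⟩
      exact DeV.Hom.mono (CABA.homToDeV (σ ≫ τ)) ha)))) rfl)

namespace MDeVe

/-- The functor sending `α : A → B` to the de Vries algebra `A`. -/
def baseFunctor : MDeVe.{u} ⥤ DeV.{u} := ObjectProperty.ι _ ⋙ DeVe.baseFunctor

/-- The functor sending `α : A → B` to the complete atomic Boolean algebra `B`. -/
def topFunctor : MDeVe.{u} ⥤ CABA.{u} := ObjectProperty.ι _ ⋙ DeVe.topFunctor

end MDeVe

/-- The map `s⁻¹ : RO(βX) → ℘(X)` of the Stone–Čech compactification `s : X → βX`. -/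
def CReg.pullbackS (X : CReg.{u}) (U : deVriesDual.obj (op (CReg.beta.obj X))) :
    tarskiDual.obj (op (CReg.points.obj X)) :=
  show Set X.obj from CReg.s X ⁻¹' RegularOpen.pts (X := CReg.beta.obj X) U

/-!
A de Vries morphism `φ : A → ℘(X)` is the same as a map from `X` to the compact Hausdorff space of
points of `A`, which sends `x` to `{a | x ∈ φ a}`, and `A` is isomorphic to the algebra of regular
open sets of that space. So an extension `A → ℘(X)` is an injection of the set `X` onto a dense
subset of a compact Hausdorff space, and its image consists of the regular open sets of the topology
induced on `X`. Since the image determines this topology, the extensions with the same image are the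
compactifications of one completely regular space, and the maximal one is the Stone–Čech
compactification, by its universal property.
-/

namespace DeV

section Hom

variable {A B C : DeV.{u}}

theorem sup_prec {a b c : A} (ha : A.prec a c) (hb : A.prec b c) : A.prec (a ⊔ b) c := by
  have h := A.isProx.dv5 _ _ (A.isProx.dv4 _ _ _ (A.isProx.dv5 _ _ ha) (A.isProx.dv5 _ _ hb))
  rwa [compl_compl, compl_inf, compl_compl, compl_compl] at h

theorem prec_of_le_of_prec {a b c : A} (hab : a ≤ b) (hbc : A.prec b c) : A.prec a c :=
  A.isProx.dv3 _ _ _ _ hab hbc le_rfl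

theorem prec_of_prec_of_le {a b c : A} (hab : A.prec a b) (hbc : b ≤ c) : A.prec a c :=
  A.isProx.dv3 _ _ _ _ le_rfl hab hbc

theorem hom_ext {f g : A ⟶ B} (h : ∀ a, fn f a = fn g a) : f = g :=
  Hom.ext (funext h)

theorem comp_apply_le (f : A ⟶ B) (g : B ⟶ C) (a : A) : fn (f ≫ g) a ≤ fn g (fn f a) :=
  Hom.starFun_le_apply g f a

theorem apply_le_comp (f : A ⟶ B) (g : B ⟶ C) {a b : A} (h : A.prec a b) :
    fn g (fn f a) ≤ fn (f ≫ g) b :=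
  Hom.le_starFun g f h

theorem fn_le_of_forall_prec {f : A ⟶ B} {b : A} {c : B} (h : ∀ a, A.prec a b → fn f a ≤ c) :
    fn f b ≤ c :=
  (Hom.map_approx f b).le.trans (sSup_le (by rintro _ ⟨a, ha, rfl⟩; exact h a ha))

theorem le_of_fn_le_fn {f : A ⟶ B} (hf : Function.Injective (fn f)) {a b : A}
    (h : fn f a ≤ fn f b) : a ≤ b :=
  inf_eq_left.1 (hf ((Hom.map_inf f a b).trans (inf_eq_left.2 h)))

theorem mono_of_injective {f : A ⟶ B} (hf : Function.Injective (fn f)) : Mono f where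
  right_cancellation {Z} g h w := by
    have fn_le : ∀ g h : Z ⟶ A, g ≫ f = h ≫ f → ∀ a, fn g a ≤ fn h a := fun g h w a =>
      fn_le_of_forall_prec fun b hb => le_of_fn_le_fn hf <| calc
        fn f (fn g b) ≤ fn (g ≫ f) a := apply_le_comp g f hb
        _ = fn (h ≫ f) a := by rw [w]
        _ ≤ fn f (fn h a) := comp_apply_le h f a
    exact hom_ext fun a => le_antisymm (fn_le g h w a) (fn_le h g w.symm a)

theorem comp_eq_id_of_leftInverse {f : A ⟶ B} {g : B ⟶ A}
    (h : Function.LeftInverse (fn g) (fn f)) : f ≫ g = 𝟙 A :=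
  hom_ext fun b => le_antisymm ((comp_apply_le f g b).trans (h b).le)
    (fn_le_of_forall_prec (f := 𝟙 A) fun a ha => (h a).ge.trans (apply_le_comp f g ha))

/-- An order isomorphism that preserves and reflects proximity, as a de Vries morphism. -/
def homOfOrderIso (e : A ≃o B) (h : ∀ a b, A.prec a b ↔ B.prec (e a) (e b)) : A ⟶ B :=
  { toFun := e
    map_bot := map_bot e
    map_inf := map_inf e
    map_prec := fun a b hab => by
      rw [map_compl' e, compl_compl]
      exact (h a b).1 hab
    map_approx := fun b => by
      refine (B.sSup_prec (e b)).trans (congrArg sSup (Set.ext fun y => ?_))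
      constructor
      · rintro ⟨c, hc, rfl⟩
        exact ⟨e.symm y, (h _ _).2 (by rwa [e.apply_symm_apply]), (e.apply_symm_apply y).symm⟩
      · rintro ⟨a, ha, rfl⟩
        exact ⟨e a, (h _ _).1 ha, rfl⟩ }

/-- The isomorphism of de Vries algebras given by an order isomorphism that preserves and reflects
proximity. -/
def isoOfOrderIso (e : A ≃o B) (h : ∀ a b, A.prec a b ↔ B.prec (e a) (e b)) : A ≅ B where
  hom := homOfOrderIso e h
  inv := homOfOrderIso e.symm fun a b => by rw [h, e.apply_symm_apply, e.apply_symm_apply]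
  hom_inv_id := comp_eq_id_of_leftInverse e.symm_apply_apply
  inv_hom_id := comp_eq_id_of_leftInverse e.apply_symm_apply

end Hom

/-! ## The space of points of a de Vries algebra -/

/-- A point (an end, or maximal round filter) of a de Vries algebra: a proper round filter that
contains `aᶜ` or `b` whenever `a ≺ b`. -/
@[ext]
structure Point (A : DeV.{u}) : Type u where
  carrier : Set A
  bot_notMem : ⊥ ∉ carrier
  inf_mem : ∀ {a b}, a ∈ carrier → b ∈ carrier → a ⊓ b ∈ carrier
  mem_of_le : ∀ {a b}, a ≤ b → a ∈ carrier → b ∈ carrier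
  compl_mem_or : ∀ {a b}, A.prec a b → aᶜ ∈ carrier ∨ b ∈ carrier
  exists_prec : ∀ {b}, b ∈ carrier → ∃ a ∈ carrier, A.prec a b

namespace Point

variable {A : DeV.{u}}

/-- The round part of a filter `G` that contains `aᶜ` or `b` whenever `a ≺ b`, as a point. -/
def ofFilter (G : Set A) (bot_notMem : ⊥ ∉ G) (inf_mem : ∀ {a b}, a ∈ G → b ∈ G → a ⊓ b ∈ G)
    (compl_mem_or : ∀ {a b}, A.prec a b → aᶜ ∈ G ∨ b ∈ G) : Point A where
  carrier := {b | ∃ a ∈ G, A.prec a b}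
  bot_notMem := by
    rintro ⟨a, ha, h⟩
    exact bot_notMem (le_bot_iff.1 (A.isProx.dv2 _ _ h) ▸ ha)
  inf_mem := by
    rintro a b ⟨c, hc, hca⟩ ⟨d, hd, hdb⟩
    exact ⟨c ⊓ d, inf_mem hc hd, A.isProx.dv4 _ _ _ (prec_of_le_of_prec inf_le_left hca)
      (prec_of_le_of_prec inf_le_right hdb)⟩
  mem_of_le := by
    rintro a b hab ⟨c, hc, hca⟩
    exact ⟨c, hc, prec_of_prec_of_le hca hab⟩
  compl_mem_or := by
    intro a b hab
    obtain ⟨c, hac, hcb⟩ := A.isProx.dv6 _ _ hab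
    obtain ⟨d, hcd, hdb⟩ := A.isProx.dv6 _ _ hcb
    exact (compl_mem_or hcd).imp (fun h => ⟨cᶜ, h, A.isProx.dv5 _ _ hac⟩) fun h => ⟨d, h, hdb⟩
  exists_prec := by
    rintro b ⟨a, ha, hab⟩
    obtain ⟨c, hac, hcb⟩ := A.isProx.dv6 _ _ hab
    exact ⟨c, ⟨a, ha, hac⟩, hcb⟩

theorem compl_notMem (p : Point A) {a : A} (h : a ∈ p.carrier) : aᶜ ∉ p.carrier := fun h' =>
  p.bot_notMem (inf_compl_self a ▸ p.inf_mem h h')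

theorem top_mem (p : Point A) : ⊤ ∈ p.carrier :=
  (p.compl_mem_or A.isProx.dv1).elim (p.mem_of_le le_top) id

theorem eq_of_carrier_subset {p q : Point A} (h : p.carrier ⊆ q.carrier) : p = q := by
  refine Point.ext (h.antisymm fun b hb => ?_)
  obtain ⟨a, ha, hab⟩ := q.exists_prec hb
  exact (p.compl_mem_or hab).resolve_left fun hac => q.compl_notMem ha (h hac)

theorem exists_mem {a : A} (ha : a ≠ ⊥) : ∃ p : Point A, a ∈ p.carrier := by
  obtain ⟨b, hb, hba⟩ := A.isProx.dv7 a ha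
  have hdisj : Disjoint (Order.PFilter.principal b : Set A) ((⊥ : Order.Ideal A) : Set A) :=
    Set.disjoint_left.2 fun x (hbx : b ≤ x) (hx : x ≤ ⊥) => hb (le_bot_iff.1 (hbx.trans hx))
  obtain ⟨J, hJ, -, hd⟩ := DistribLattice.prime_ideal_of_disjoint_filter_ideal hdisj
  refine ⟨ofFilter {x | x ∉ J} (fun h => h J.bot_mem)
    (fun hc hd h => (hJ.mem_or_mem h).elim hc hd) fun {c d} hcd => ?_,
    b, Set.disjoint_left.1 hd (show b ≤ b from le_rfl), hba⟩
  by_contra! h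
  exact hJ.toIsProper.notMem_of_compl_mem (not_not.1 h.1)
    (J.lower (A.isProx.dv2 _ _ hcd) (not_not.1 h.2))

/-- The set of points that contain `a`; these sets form a basis of the topology on `Point A`. -/
def basic (a : A) : Set (Point A) := {p | a ∈ p.carrier}

theorem basic_inf (a b : A) : basic (a ⊓ b) = basic a ∩ basic b :=
  Set.ext fun p => ⟨fun h => ⟨p.mem_of_le inf_le_left h, p.mem_of_le inf_le_right h⟩,
    fun h => p.inf_mem h.1 h.2⟩

theorem disjoint_basic_iff {a b : A} : Disjoint (basic a) (basic b) ↔ a ≤ bᶜ := by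
  rw [le_compl_iff_disjoint_right, Set.disjoint_iff_inter_eq_empty, ← basic_inf,
    Set.eq_empty_iff_forall_notMem, disjoint_iff]
  refine ⟨fun h => ?_, fun h p => h ▸ p.bot_notMem⟩
  by_contra hab
  obtain ⟨p, hp⟩ := exists_mem hab
  exact h p hp

theorem basic_subset_iff {a b : A} : basic a ⊆ basic b ↔ a ≤ b := by
  refine ⟨fun h => ?_, fun h p => p.mem_of_le h⟩
  rw [← compl_compl b, ← disjoint_basic_iff]
  exact Set.disjoint_left.2 fun p ha => p.compl_notMem (h ha)

instance : TopologicalSpace (Point A) := generateFrom (Set.range basic)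

theorem isTopologicalBasis : IsTopologicalBasis (Set.range (basic : A → Set (Point A))) where
  exists_subset_inter := by
    rintro _ ⟨a, rfl⟩ _ ⟨b, rfl⟩ p hp
    exact ⟨_, ⟨a ⊓ b, rfl⟩, by rwa [basic_inf], (basic_inf a b).le⟩
  sUnion_eq := Set.eq_univ_of_forall fun p => ⟨_, ⟨⊤, rfl⟩, p.top_mem⟩
  eq_generateFrom := rfl

theorem isOpen_basic (a : A) : IsOpen (basic a) := isTopologicalBasis.isOpen ⟨a, rfl⟩

instance : T2Space (Point A) where
  t2 p q hpq := by
    obtain ⟨b, hbp, hbq⟩ := Set.not_subset.1 (mt eq_of_carrier_subset hpq)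
    obtain ⟨a, ha, hab⟩ := p.exists_prec hbp
    exact ⟨basic a, basic aᶜ, isOpen_basic a, isOpen_basic aᶜ, ha,
      (q.compl_mem_or hab).resolve_right hbq, disjoint_basic_iff.2 (compl_compl a).ge⟩

instance : CompactSpace (Point A) := by
  refine ⟨isCompact_iff_ultrafilter_le_nhds.2 fun 𝒰 _ => ?_⟩
  refine ⟨ofFilter {a | basic a ∈ 𝒰} (fun h => ?_) (fun {a b} ha hb => ?_) (fun {a b} hab => ?_),
    Set.mem_univ _, fun s hs => ?_⟩
  · obtain ⟨p, hp⟩ := 𝒰.nonempty_of_mem h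
    exact p.bot_notMem hp
  · rw [Set.mem_ofPred_eq, basic_inf]
    exact Filter.inter_mem ha hb
  · have hcover : basic aᶜ ∪ basic b = Set.univ :=
      Set.eq_univ_of_forall fun p => p.compl_mem_or hab
    exact Ultrafilter.union_mem_iff.1 (hcover ▸ Filter.univ_mem)
  · obtain ⟨_, ⟨b, rfl⟩, ⟨a, ha, hab⟩, hbs⟩ := isTopologicalBasis.mem_nhds_iff.1 hs
    exact Filter.mem_of_superset ha ((basic_subset_iff.2 (A.isProx.dv2 _ _ hab)).trans hbs)

theorem interior_compl_eq_basic {U : Set (Point A)} (hU : IsOpen U) :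
    interior Uᶜ = basic (sSup {b : A | basic b ⊆ U})ᶜ := by
  refine Set.Subset.antisymm (fun p hp => ?_) (interior_maximal (fun q hq hqU => ?_)
    (isOpen_basic _))
  · obtain ⟨_, ⟨c, rfl⟩, hpc, hcU⟩ :=
      isTopologicalBasis.mem_nhds_iff.1 (mem_interior_iff_mem_nhds.1 hp)
    refine basic_subset_iff.2 (le_compl_comm.1 (sSup_le fun b hb => ?_)) hpc
    exact disjoint_basic_iff.1 (Set.disjoint_left.2 fun q hqb hqc => hcU hqc (hb hqb))
  · obtain ⟨_, ⟨b, rfl⟩, hqb, hbU⟩ := isTopologicalBasis.exists_subset_of_mem_open hqU hU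
    exact q.compl_notMem (q.mem_of_le (le_sSup hbU) hqb) hq

theorem interior_compl_basic (a : A) : interior (basic a)ᶜ = basic aᶜ := by
  simp only [interior_compl_eq_basic (isOpen_basic a), basic_subset_iff]
  exact congrArg (fun b => basic bᶜ) csSup_Iic

theorem closure_basic (a : A) : closure (basic a) = (basic aᶜ)ᶜ := by
  rw [← interior_compl_basic, interior_compl, compl_compl]

theorem interior_closure_basic (a : A) : interior (closure (basic a)) = basic a := by
  rw [closure_basic, interior_compl_basic, compl_compl]

theorem prec_iff_closure_basic_subset {a b : A} :
    A.prec a b ↔ closure (basic a) ⊆ basic b := by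
  refine ⟨fun h p hp => ?_, fun h => ?_⟩
  · rw [closure_basic] at hp
    exact (p.compl_mem_or h).resolve_left hp
  · have : Nonempty {c // A.prec c b} := ⟨⊥, prec_of_prec_of_le A.bot_prec_bot bot_le⟩
    obtain ⟨⟨c, hc⟩, hac⟩ := isClosed_closure.isCompact.elim_directed_cover
      (fun c : {c // A.prec c b} => basic c.1) (fun c => isOpen_basic _)
      (fun p hp => by
        obtain ⟨c, hpc, hcb⟩ := p.exists_prec (h hp)
        exact Set.mem_iUnion.2 ⟨⟨c, hcb⟩, hpc⟩)
      (fun c d => ⟨⟨c.1 ⊔ d.1, sup_prec c.2 d.2⟩, basic_subset_iff.2 le_sup_left,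
        basic_subset_iff.2 le_sup_right⟩)
    exact prec_of_le_of_prec (basic_subset_iff.1 (subset_closure.trans hac)) hc

/-- `basic`, as an order isomorphism from `A` to the regular open sets of its space of points. -/
noncomputable def regularOpenIso (A : DeV.{u}) : A ≃o RegularOpen (Point A) :=
  RelIso.ofSurjective (OrderEmbedding.ofMapLEIff
    (fun a => (⟨⟨basic a, isOpen_basic a⟩,
      (RegularOpen.isRegular_iff _).2 (interior_closure_basic a)⟩ : RegularOpen (Point A)))
    fun _ _ => basic_subset_iff) fun U => by
      have hU : U.pts = interior (interior U.ptsᶜ)ᶜ := by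
        rw [← closure_compl, compl_compl, U.interior_closure_pts]
      rw [interior_compl_eq_basic U.isOpen_pts, interior_compl_basic] at hU
      exact ⟨_, Heyting.Regular.coe_injective (SetLike.coe_injective hU.symm)⟩

end Point

/-- A de Vries algebra is isomorphic to the regular open sets of its space of points. -/
noncomputable def pointIso (A : DeV.{u}) : A ≅ deVriesDual.obj (op (CompHaus.of (Point A))) :=
  isoOfOrderIso (B := (CompHaus.of (Point A)).regularOpens) (Point.regularOpenIso A) fun _ _ =>
    Point.prec_iff_closure_basic_subset

end DeV

instance : deVriesDual.{u}.EssSurj where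
  mem_essImage A := ⟨op (CompHaus.of (DeV.Point A)), ⟨A.pointIso.symm⟩⟩

/-! ## De Vries morphisms into powersets -/

namespace DeV

/-- The algebra of subsets of `X`, as a de Vries algebra. -/
abbrev powerset (X : Type u) : DeV.{u} := (tarskiDual.obj (op X)).toDeV

variable {A B : DeV.{u}} {X : Type u}

/-- The values of a de Vries morphism into a powerset, as sets. -/
def toSet (φ : A ⟶ powerset X) (a : A) : Set X := fn φ a

theorem powerset_hom_ext {φ ψ : A ⟶ powerset X} (h : ∀ a, toSet φ a = toSet ψ a) : φ = ψ :=
  hom_ext h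

theorem toSet_bot (φ : A ⟶ powerset X) : toSet φ ⊥ = ∅ := Hom.map_bot φ

theorem toSet_inf (φ : A ⟶ powerset X) (a b : A) : toSet φ (a ⊓ b) = toSet φ a ∩ toSet φ b :=
  Hom.map_inf φ a b

theorem toSet_mono (φ : A ⟶ powerset X) {a b : A} (h : a ≤ b) : toSet φ a ⊆ toSet φ b :=
  Hom.mono φ h

theorem mem_toSet_compl_or (φ : A ⟶ powerset X) {a b : A} (h : A.prec a b) (x : X) :
    x ∈ toSet φ aᶜ ∨ x ∈ toSet φ b :=
  or_iff_not_imp_left.2 fun hx => (show (toSet φ aᶜ)ᶜ ⊆ toSet φ b from Hom.map_prec φ a b h) hx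

theorem toSet_comp (f : A ⟶ B) (φ : B ⟶ powerset X) (b : A) :
    toSet (f ≫ φ) b = ⋃ (a) (_ : A.prec a b), toSet φ (fn f a) := by
  have h : toSet (f ≫ φ) b = ⋃₀ {y | ∃ a, A.prec a b ∧ y = toSet φ (fn f a)} := rfl
  ext x
  simp only [h, Set.mem_sUnion, Set.mem_ofPred_eq, Set.mem_iUnion, exists_prop]
  exact ⟨fun ⟨_, ⟨a, ha, hy⟩, hx⟩ => ⟨a, ha, hy ▸ hx⟩, fun ⟨a, ha, hx⟩ => ⟨_, ⟨a, ha, rfl⟩, hx⟩⟩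

theorem toSet_eq_iUnion (φ : A ⟶ powerset X) (b : A) :
    toSet φ b = ⋃ (a) (_ : A.prec a b), toSet φ a :=
  (congrArg (toSet · b) (Category.id_comp φ)).symm.trans (toSet_comp (𝟙 A) φ b)

theorem isOpen_toSet_comp [TopologicalSpace X] (f : A ⟶ B) {φ : B ⟶ powerset X}
    (hφ : ∀ b, IsOpen (toSet φ b)) (a : A) : IsOpen (toSet (f ≫ φ) a) := by
  rw [toSet_comp]
  exact isOpen_biUnion fun b _ => hφ (fn f b)

/-- The map from `X` to the points of `A` given by a de Vries morphism `φ : A ⟶ ℘(X)`; it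
determines `φ`, since the inverse image of `Point.basic a` is `φ a`. -/
def pointOf (φ : A ⟶ powerset X) (x : X) : Point A where
  carrier := {a | x ∈ toSet φ a}
  bot_notMem h := (toSet_bot φ).le h
  inf_mem {a b} ha hb := (toSet_inf φ a b).ge ⟨ha, hb⟩
  mem_of_le h ha := toSet_mono φ h ha
  compl_mem_or h := mem_toSet_compl_or φ h x
  exists_prec {b} hb := by
    obtain ⟨a, ha, hx⟩ := Set.mem_iUnion₂.1 ((toSet_eq_iUnion φ b).le hb)
    exact ⟨a, hx, ha⟩

theorem continuous_pointOf [TopologicalSpace X] {φ : A ⟶ powerset X}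
    (hφ : ∀ a, IsOpen (toSet φ a)) : Continuous (pointOf φ) :=
  Point.isTopologicalBasis.continuous_iff.2 (Set.forall_mem_range.2 hφ)

theorem denseRange_pointOf {φ : A ⟶ powerset X} (hφ : Function.Injective (fn φ)) :
    DenseRange (pointOf φ) := by
  refine Point.isTopologicalBasis.dense_iff.2 ?_
  rintro _ ⟨a, rfl⟩ ⟨p, hp⟩
  have ha : toSet φ a ≠ ∅ := fun h =>
    p.bot_notMem (hφ (h.trans (toSet_bot φ).symm) ▸ hp)
  obtain ⟨x, hx⟩ := Set.nonempty_iff_ne_empty.2 ha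
  exact ⟨pointOf φ x, hx, x, rfl⟩

theorem joinMeetDense_iff_forall_set {φ : A ⟶ powerset X} :
    JoinMeetDense φ ↔ ∀ T : Set X, ∃ S : Set (Set X),
      (∀ s ∈ S, ∃ M ⊆ Set.range (toSet φ), s = ⋂₀ M) ∧ T = ⋃₀ S :=
  Iff.rfl

theorem joinMeetDense_iff_injective_pointOf {φ : A ⟶ powerset X} :
    JoinMeetDense φ ↔ Function.Injective (pointOf φ) := by
  rw [joinMeetDense_iff_forall_set]
  refine ⟨fun h x x' hxx' => ?_, fun h T => ?_⟩
  · obtain ⟨S, hS, hx⟩ := h {x}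
    obtain ⟨s, hs, hxs⟩ := hx.le rfl
    obtain ⟨M, hM, rfl⟩ := hS s hs
    have hx's : x' ∈ ⋂₀ M := fun m hm => by
      obtain ⟨a, rfl⟩ := hM hm
      have hp : a ∈ (pointOf φ x).carrier := hxs _ hm
      rwa [hxx'] at hp
    exact (hx.ge ⟨_, hs, hx's⟩ : x' = x).symm
  · refine ⟨(fun x => {x}) '' T, ?_, by rw [Set.sUnion_image, Set.biUnion_of_singleton]⟩
    rintro _ ⟨x, -, rfl⟩
    refine ⟨{m | x ∈ m} ∩ Set.range (toSet φ), Set.inter_subset_right,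
      Set.Subset.antisymm ?_ fun z hz => ?_⟩
    · rintro _ rfl m hm
      exact hm.1
    · refine (h (Point.eq_of_carrier_subset fun a ha => ?_)).symm
      exact hz _ ⟨ha, a, rfl⟩

end DeV

/-! ## Regular open sets and continuous maps -/

namespace RegularOpen

theorem isTopologicalBasis_pts {Y : Type u} [TopologicalSpace Y] [RegularSpace Y] :
    IsTopologicalBasis (Set.range (pts : RegularOpen Y → Set Y)) := by
  refine isTopologicalBasis_of_isOpen_of_nhds (Set.forall_mem_range.2 isOpen_pts)
    fun y W hy hW => ?_
  obtain ⟨F, hF, hFc, hFW⟩ := exists_mem_nhds_isClosed_subset (hW.mem_nhds hy)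
  refine ⟨_, ⟨reg (interior F) isOpen_interior, rfl⟩,
    subset_reg _ _ (mem_interior_iff_mem_nhds.2 hF), ?_⟩
  rw [pts_reg]
  exact interior_subset.trans ((closure_minimal interior_subset hFc).trans hFW)

theorem eq_of_forall_mem_pts {Y : Type u} [TopologicalSpace Y] [T3Space Y] {y z : Y}
    (h : ∀ U : RegularOpen Y, y ∈ U.pts → z ∈ U.pts) : y = z := by
  by_contra hyz
  obtain ⟨_, ⟨U, rfl⟩, hy, hU⟩ := isTopologicalBasis_pts.exists_subset_of_mem_open
    (show y ∈ ({z} : Set Y)ᶜ from hyz) isOpen_compl_singleton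
  exact hU (h U hy) rfl

theorem le_of_preimage_subset {X : Type*} {Y : Type u} [TopologicalSpace Y] {f : X → Y}
    (hf : DenseRange f) {U V : RegularOpen Y} (h : f ⁻¹' U.pts ⊆ f ⁻¹' V.pts) : U ≤ V := by
  have hUV : U.pts ⊆ closure V.pts := calc
    U.pts ⊆ closure (U.pts ∩ Set.range f) := hf.open_subset_closure_inter U.isOpen_pts
    _ ⊆ closure V.pts := closure_mono (by rintro _ ⟨hU, x, rfl⟩; exact h hU)
  rw [pts_le, ← V.interior_closure_pts]
  exact interior_maximal hUV U.isOpen_pts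

section DenseSubspace

variable {X : Type*} {Y : Type u} [TopologicalSpace X] [TopologicalSpace Y] {f : X → Y}

theorem closure_preimage_of_isDenseInducing (hf : IsDenseInducing f) {U : Set Y} (hU : IsOpen U) :
    closure (f ⁻¹' U) = f ⁻¹' closure U := by
  rw [hf.isInducing.closure_eq_preimage_closure_image, Set.image_preimage_eq_inter_range,
    (closure_mono Set.inter_subset_left).antisymm
      (closure_minimal (hf.dense.open_subset_closure_inter hU) isClosed_closure)]

theorem interior_closure_preimage_of_isDenseInducing (hf : IsDenseInducing f) {U : Set Y}
    (hU : IsOpen U) : interior (closure (f ⁻¹' U)) = f ⁻¹' interior (closure U) := by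
  rw [closure_preimage_of_isDenseInducing hf hU, interior_eq_compl_closure_compl,
    interior_eq_compl_closure_compl, ← Set.preimage_compl,
    closure_preimage_of_isDenseInducing hf isClosed_closure.isOpen_compl, Set.preimage_compl]

theorem exists_preimage_pts_eq_iff (hf : IsDenseInducing f) {V : Set X} :
    (∃ U : RegularOpen Y, f ⁻¹' U.pts = V) ↔ interior (closure V) = V := by
  constructor
  · rintro ⟨U, rfl⟩
    rw [interior_closure_preimage_of_isDenseInducing hf U.isOpen_pts, U.interior_closure_pts]
  · intro hV
    obtain ⟨W, hW, rfl⟩ := hf.isInducing.isOpen_iff.1 (hV ▸ isOpen_interior : IsOpen V)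
    refine ⟨reg W hW, ?_⟩
    rw [pts_reg, ← interior_closure_preimage_of_isDenseInducing hf hW, hV]

end DenseSubspace

end RegularOpen

namespace DeV

open RegularOpen

variable {X : Type u} {Y Z : CompHaus.{u}}

/-- The inverse image map on regular open sets, as a de Vries morphism into the powerset. The map
`f` need not be continuous; it is so exactly if the values of `preimageHom f` are open. -/
def preimageHom (f : X → Y) : deVriesDual.obj (op Y) ⟶ powerset X :=
  { toFun := fun U => f ⁻¹' U.pts
    map_bot := rfl
    map_inf := fun _ _ => rfl
    map_prec := fun (U V : RegularOpen Y) hUV => by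
      change (f ⁻¹' (Uᶜ).pts)ᶜ ⊆ f ⁻¹' V.pts
      rw [pts_compl, interior_compl, Set.preimage_compl, compl_compl]
      exact Set.preimage_mono hUV
    map_approx := fun V => by
      change f ⁻¹' V.pts = ⋃₀ {y | ∃ U, Prec U V ∧ y = f ⁻¹' U.pts}
      refine Set.Subset.antisymm (fun x hx => ?_) (Set.sUnion_subset ?_)
      · obtain ⟨U, hU, hUV⟩ := exists_prec V hx
        exact ⟨_, ⟨U, hUV, rfl⟩, hU⟩
      · rintro _ ⟨U, hUV, rfl⟩
        exact Set.preimage_mono (subset_closure.trans hUV) }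

instance (Y : CompHaus.{u}) : T3Space Y :=
  have : T35Space Y := CReg.t35Space_of_compact Y
  T35Space.instT3space

theorem continuous_iff_isOpen_toSet_preimageHom [TopologicalSpace X] {f : X → Y} :
    Continuous f ↔ ∀ U, IsOpen (toSet (preimageHom f) U) :=
  have : RegularSpace Y := T3Space.toRegularSpace
  isTopologicalBasis_pts.continuous_iff.trans Set.forall_mem_range

theorem preimageHom_injective : Function.Injective (preimageHom : (X → Y) → _) := fun f g h =>
  funext fun x => eq_of_forall_mem_pts fun U hU => by
    have hx : x ∈ toSet (preimageHom f) U := hU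
    rwa [h] at hx

theorem exists_eq_pointOf_preimageHom_id (p : Point (deVriesDual.obj (op Y))) :
    ∃ y : Y, p = pointOf (preimageHom id) y := by
  have hne : (⋂ U : p.carrier, closure (pts (X := Y) U.1)).Nonempty := by
    refine IsCompact.nonempty_iInter_of_directed_nonempty_isCompact_isClosed
      (hι := ⟨⟨⊤, p.top_mem⟩⟩) _ (fun U V => ?_) (fun U => ?_)
      (fun U => isClosed_closure.isCompact) (fun U => isClosed_closure)
    · exact ⟨⟨_, p.inf_mem U.2 V.2⟩, closure_mono Set.inter_subset_left,
        closure_mono Set.inter_subset_right⟩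
    · refine Set.Nonempty.closure (Set.nonempty_iff_ne_empty.2 fun h => ?_)
      exact p.bot_notMem (le_bot_iff.1 (pts_le.2 h.le) ▸ U.2)
  obtain ⟨y, hy⟩ := hne
  refine ⟨y, Point.eq_of_carrier_subset fun U hU => ?_⟩
  obtain ⟨V, hV, hVU⟩ := p.exists_prec hU
  exact hVU (Set.mem_iInter.1 hy ⟨V, hV⟩)

theorem preimageHom_surjective : Function.Surjective (preimageHom : (X → Y) → _) := fun φ => by
  choose f hf using fun x => exists_eq_pointOf_preimageHom_id (pointOf φ x)
  exact ⟨f, powerset_hom_ext fun U => Set.ext fun x =>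
    (Set.ext_iff.1 (congrArg Point.carrier (hf x)) U).symm⟩

theorem map_comp_preimageHom (g : Y ⟶ Z) (f : X → Y) :
    deVriesDual.map g.op ≫ preimageHom f = preimageHom (g ∘ f) := by
  refine powerset_hom_ext fun V => (toSet_comp _ _ _).trans (Set.Subset.antisymm ?_ ?_)
  · exact Set.iUnion₂_subset fun U hUV =>
      Set.preimage_mono (pts_pullback_subset g g.hom.hom.continuous hUV)
  · rw [toSet_eq_iUnion]
    exact Set.iUnion₂_mono fun (U : RegularOpen Z) _ => Set.preimage_mono (f := f)
      (subset_reg (g ⁻¹' U.pts) (U.isOpen_pts.preimage g.hom.hom.continuous))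

theorem pointIso_hom_comp_preimageHom {A : DeV.{u}} (φ : A ⟶ powerset X) :
    A.pointIso.hom ≫ preimageHom (Y := CompHaus.of (Point A)) (pointOf φ) = φ :=
  powerset_hom_ext fun a => (toSet_comp _ _ _).trans (toSet_eq_iUnion φ a).symm

theorem preimageHom_fn_injective {f : X → Y} (hf : DenseRange f) :
    Function.Injective (fn (preimageHom f)) := fun _ _ h =>
  le_antisymm (le_of_preimage_subset hf h.le) (le_of_preimage_subset hf h.ge)

theorem joinMeetDense_preimageHom {f : X → Y} (hf : Function.Injective f) :
    JoinMeetDense (preimageHom f) :=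
  joinMeetDense_iff_injective_pointOf.2 fun _ _ h =>
    hf (eq_of_forall_mem_pts fun _ hU => (congrArg Point.carrier h).le hU)

theorem isDeVriesExtension_preimageHom {f : X → Y} (hd : DenseRange f)
    (hf : Function.Injective f) :
    IsDeVriesExtension (B := tarskiDual.obj (op X)) (preimageHom f) :=
  ⟨preimageHom_fn_injective hd, joinMeetDense_preimageHom hf⟩

instance mono_preimageHom_id (Y : CompHaus.{u}) : Mono (preimageHom (id : Y → Y)) :=
  mono_of_injective (preimageHom_fn_injective Function.surjective_id.denseRange)

end DeV

instance : deVriesDual.{u}.Faithful where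
  map_injective {Y Z} f g h := by
    have hcomp := congrArg (· ≫ DeV.preimageHom (id : Z.unop → Z.unop)) h
    have hfun : f.unop ∘ id = g.unop ∘ id := DeV.preimageHom_injective <|
      (DeV.map_comp_preimageHom f.unop id).symm.trans
        (hcomp.trans (DeV.map_comp_preimageHom g.unop id))
    exact Quiver.Hom.unop_inj (ConcreteCategory.hom_ext _ _ (congrFun hfun))

instance : deVriesDual.{u}.Full where
  map_surjective {Y Z} ρ := by
    obtain ⟨f, hf⟩ := DeV.preimageHom_surjective (ρ ≫ DeV.preimageHom (id : Z.unop → Z.unop))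
    have hc : Continuous f := DeV.continuous_iff_isOpen_toSet_preimageHom.2 <| by
      rw [hf]
      exact DeV.isOpen_toSet_comp ρ (DeV.continuous_iff_isOpen_toSet_preimageHom.1 continuous_id)
    let g : Z.unop ⟶ Y.unop := CompHausLike.ofHom _ ⟨f, hc⟩
    refine ⟨g.op, (cancel_mono (DeV.preimageHom (id : Z.unop → Z.unop))).1 ?_⟩
    exact (DeV.map_comp_preimageHom g id).trans hf

instance : deVriesDual.{u}.IsEquivalence where

/-! ## Tarski duality -/

namespace CABA

variable {B C : CABA.{u}}

theorem hom_ext {σ τ : B ⟶ C} (h : ∀ b, fn σ b = fn τ b) : σ = τ :=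
  CompleteLatticeHom.ext h

theorem map_sSup_fn (σ : B ⟶ C) (S : Set B) : fn σ (sSup S) = sSup (fn σ '' S) :=
  map_sSup (show CompleteLatticeHom B C from σ) S

theorem map_sInf_fn (σ : B ⟶ C) (S : Set B) : fn σ (sInf S) = sInf (fn σ '' S) :=
  map_sInf (show CompleteLatticeHom B C from σ) S

theorem fn_inv_fn_hom (e : B ≅ C) (b : B) : fn e.inv (fn e.hom b) = b :=
  congrArg (fn · b) e.hom_inv_id

theorem fn_hom_fn_inv (e : B ≅ C) (c : C) : fn e.hom (fn e.inv c) = c :=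
  fn_inv_fn_hom e.symm c

/-- An order isomorphism, as a complete Boolean homomorphism. -/
def homOfOrderIso (e : B ≃o C) : B ⟶ C :=
  show CompleteLatticeHom B C from
  { toFun := e
    map_sInf' := fun S => (e.map_sInf S).trans sInf_image.symm
    map_sSup' := fun S => (e.map_sSup S).trans sSup_image.symm }

/-- The isomorphism of complete and atomic Boolean algebras given by an order isomorphism. -/
def isoOfOrderIso (e : B ≃o C) : B ≅ C where
  hom := homOfOrderIso e
  inv := homOfOrderIso e.symm
  hom_inv_id := hom_ext e.symm_apply_apply
  inv_hom_id := hom_ext e.apply_symm_apply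

/-- A complete and atomic Boolean algebra is isomorphic to the powerset of its set of atoms. -/
noncomputable def atomsPowersetIso (B : CABA.{u}) : B ≅ tarskiDual.obj (op {a : B // IsAtom a}) :=
  let _ : CompleteAtomicBooleanAlgebra B :=
    CompleteBooleanAlgebra.toCompleteAtomicBooleanAlgebra
  isoOfOrderIso (C := tarskiDual.obj (op {a : B // IsAtom a}))
    CompleteAtomicBooleanAlgebra.toSetOfIsAtom

theorem exists_setPreimage_eq {X Y : Type u} (σ : CompleteLatticeHom (Set Y) (Set X)) :
    ∃ f : X → Y, CompleteLatticeHom.setPreimage f = σ := by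
  have hcover : ⋃ y, σ {y} = Set.univ := calc
    ⋃ y, σ {y} = σ (⋃ y, {y}) := (map_iSup σ _).symm
    _ = Set.univ := by rw [Set.iUnion_of_singleton]; exact map_top σ
  choose f hf using fun x => Set.mem_iUnion.1 (hcover.ge (Set.mem_univ x))
  have preimage_subset : ∀ S, f ⁻¹' S ⊆ σ S := fun S x hx =>
    (OrderHomClass.mono σ (Set.singleton_subset_iff.2 hx) : σ {f x} ⊆ σ S) (hf x)
  refine ⟨f, CompleteLatticeHom.ext fun S => Set.Subset.antisymm (preimage_subset S) ?_⟩
  have h := preimage_subset Sᶜ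
  rwa [map_compl', Set.preimage_compl, Set.compl_subset_compl] at h

end CABA

instance : tarskiDual.{u}.Faithful where
  map_injective {Y Z} f g h := by
    refine Quiver.Hom.unop_inj (ConcreteCategory.hom_ext _ _ fun z => ?_)
    have hz : f.unop ⁻¹' {g.unop z} = g.unop ⁻¹' {g.unop z} :=
      congrArg (fun σ => (CABA.fn σ ({g.unop z} : Set Y.unop) : Set Z.unop)) h
    exact hz.ge (rfl : g.unop z = g.unop z)

instance : tarskiDual.{u}.Full where
  map_surjective {Y Z} σ :=
    let ⟨f, hf⟩ := CABA.exists_setPreimage_eq (X := Z.unop) (Y := Y.unop) σ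
    ⟨(TypeCat.ofHom f).op, hf⟩

instance : tarskiDual.{u}.EssSurj where
  mem_essImage B := ⟨op {a : B // IsAtom a}, ⟨B.atomsPowersetIso.symm⟩⟩

instance : tarskiDual.{u}.IsEquivalence where

/-! ## Morphisms of de Vries extensions -/

namespace CABA

variable {A : DeV.{u}} {B C : CABA.{u}}

/-- A complete Boolean homomorphism, as a morphism of `DeV`. -/
abbrev toDeVHom (σ : B ⟶ C) : B.toDeV ⟶ C.toDeV := homToDeV σ

theorem comp_toDeVHom_apply (α : A ⟶ B.toDeV) (σ : B ⟶ C) (a : A) :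
    DeV.fn (α ≫ toDeVHom σ) a = fn σ (DeV.fn α a) := by
  have happrox : fn σ (DeV.fn α a) = sSup (fn σ '' {y | ∃ b, A.prec b a ∧ y = DeV.fn α b}) :=
    (congrArg (fn σ) (DeV.Hom.map_approx α a)).trans (map_sSup_fn σ _)
  refine le_antisymm (DeV.comp_apply_le _ _ a) (happrox.trans_le (sSup_le ?_))
  rintro _ ⟨_, ⟨b, hb, rfl⟩, rfl⟩
  exact DeV.apply_le_comp α (toDeVHom σ) hb

end CABA

namespace IsDeVriesExtension

variable {A : DeV.{u}} {B C : CABA.{u}} {α : A ⟶ B.toDeV}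

theorem mono (h : IsDeVriesExtension α) : Mono α :=
  DeV.mono_of_injective h.injective

theorem comp_iso (h : IsDeVriesExtension α) (e : B ≅ C) :
    IsDeVriesExtension (α ≫ CABA.toDeVHom e.hom) where
  injective a b hab := by
    rw [CABA.comp_toDeVHom_apply, CABA.comp_toDeVHom_apply] at hab
    exact h.injective (Function.LeftInverse.injective (CABA.fn_inv_fn_hom e) hab)
  dense c := by
    obtain ⟨S, hS, hc⟩ := h.dense (CABA.fn e.inv c)
    refine ⟨CABA.fn e.hom '' S, ?_, ?_⟩
    · rintro _ ⟨s, hs, rfl⟩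
      obtain ⟨M, hM, rfl⟩ := hS s hs
      refine ⟨CABA.fn e.hom '' M, ?_, CABA.map_sInf_fn e.hom M⟩
      rintro _ ⟨m, hm, rfl⟩
      obtain ⟨a, rfl⟩ := hM hm
      exact ⟨a, CABA.comp_toDeVHom_apply _ _ _⟩
    · rw [← CABA.fn_hom_fn_inv e c, hc]
      exact CABA.map_sSup_fn e.hom S

end IsDeVriesExtension

theorem DeVe.Hom.w {E E' : DeVe.{u}} (f : Hom E E') :
    f.ρ ≫ E'.map = E.map ≫ CABA.toDeVHom f.σ :=
  DeV.hom_ext fun a => (f.comm a).symm.trans (CABA.comp_toDeVHom_apply E.map f.σ a).symm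

namespace MDeVe

instance : topFunctor.{u}.Faithful where
  map_injective {E E'} f g (h : f.hom.σ = g.hom.σ) := by
    have := E'.obj.isExt.mono
    refine ObjectProperty.hom_ext _ (DeVe.Hom.ext ((cancel_mono E'.obj.map).1 ?_) h)
    exact (DeVe.Hom.w f.hom).trans (h ▸ (DeVe.Hom.w g.hom).symm)

theorem exists_topFunctor_map_eq {E E' : MDeVe.{u}} (e : E.obj.top ≅ E'.obj.top)
    (h : CABA.fn e.hom '' Set.range E.obj.fn = Set.range E'.obj.fn) :
    ∃ f : E ⟶ E', topFunctor.map f = e.hom := by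
  have hrange : Set.range (DeV.fn (E.obj.map ≫ CABA.toDeVHom e.hom)) = Set.range E'.obj.fn := by
    rw [← h, ← Set.range_comp]
    exact congrArg Set.range (funext (CABA.comp_toDeVHom_apply _ _))
  obtain ⟨δ, hδ⟩ := E'.property _ _ (E.obj.isExt.comp_iso e) hrange.symm
  refine ⟨ObjectProperty.homMk { ρ := δ, σ := e.hom, comm := fun a => ?_ }, rfl⟩
  rw [hδ, CABA.comp_toDeVHom_apply]

theorem nonempty_iso_of_image_range_eq {E E' : MDeVe.{u}} (e : E.obj.top ≅ E'.obj.top)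
    (h : CABA.fn e.hom '' Set.range E.obj.fn = Set.range E'.obj.fn) : Nonempty (E ≅ E') := by
  have h' : CABA.fn e.inv '' Set.range E'.obj.fn = Set.range E.obj.fn := by
    rw [← h, Function.LeftInverse.image_image (CABA.fn_inv_fn_hom e)]
  obtain ⟨f, hf⟩ := exists_topFunctor_map_eq e h
  obtain ⟨g, hg⟩ := exists_topFunctor_map_eq e.symm h'
  refine ⟨⟨f, g, topFunctor.map_injective ?_, topFunctor.map_injective ?_⟩⟩
  · rw [Functor.map_comp, hf, hg]
    exact e.hom_inv_id
  · rw [Functor.map_comp, hf, hg]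
    exact e.inv_hom_id

end MDeVe

instance : CABA.toMDeVe.{u}.Faithful where
  map_injective h := congrArg MDeVe.topFunctor.map h

instance : CABA.toMDeVe.{u}.Full where
  map_surjective f := ⟨MDeVe.topFunctor.map f, MDeVe.topFunctor.map_injective rfl⟩

/-! ## The maximal de Vries extension of a completely regular space -/

namespace CReg

open DeV

theorem isDenseEmbedding_s (X : CReg.{u}) : IsDenseEmbedding X.s :=
  have := X.property
  isDenseEmbedding_stoneCechUnit

theorem exists_extend (X : CReg.{u}) {Y : CompHaus.{u}} {f : X.obj → Y} (hf : Continuous f) :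
    ∃ g : beta.obj X ⟶ Y, g ∘ X.s = f :=
  ⟨CompHausLike.ofHom _ ⟨stoneCechExtend hf, continuous_stoneCechExtend hf⟩,
    stoneCechExtend_extends hf⟩

theorem beta_map_comp_s {X Y : CReg.{u}} (f : X ⟶ Y) : beta.map f ∘ X.s = Y.s ∘ f :=
  stoneCechExtend_extends (continuous_stoneCechUnit.comp f.hom.hom.continuous)

theorem isDeVriesExtension_preimageHom_s (X : CReg.{u}) :
    IsDeVriesExtension (B := tarskiDual.obj (op (points.obj X))) (preimageHom X.s) :=
  isDeVriesExtension_preimageHom X.isDenseEmbedding_s.dense X.isDenseEmbedding_s.injective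

theorem isOpen_toSet_preimageHom_s (X : CReg.{u}) (U) : IsOpen (toSet (preimageHom X.s) U) :=
  continuous_iff_isOpen_toSet_preimageHom.1 X.isDenseEmbedding_s.continuous U

theorem exists_comp_preimageHom_s_eq (X : CReg.{u}) {C : DeV.{u}} (γ : C ⟶ powerset X.obj)
    (hγ : ∀ c, IsOpen (toSet γ c)) :
    ∃ δ : C ⟶ deVriesDual.obj (op (beta.obj X)), δ ≫ preimageHom X.s = γ := by
  obtain ⟨g, hg⟩ := X.exists_extend (Y := CompHaus.of (Point C)) (continuous_pointOf hγ)
  refine ⟨C.pointIso.hom ≫ deVriesDual.map g.op, ?_⟩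
  rw [Category.assoc, map_comp_preimageHom, hg, pointIso_hom_comp_preimageHom]

/-- The maximal de Vries extension `s⁻¹ : RO(βX) → ℘(X)`. -/
noncomputable def extension (X : CReg.{u}) : MDeVe.{u} where
  obj :=
    { base := deVriesDual.obj (op (beta.obj X))
      top := tarskiDual.obj (op (points.obj X))
      map := preimageHom X.s
      isExt := X.isDeVriesExtension_preimageHom_s }
  property := fun _ γ _ hrange => X.exists_comp_preimageHom_s_eq γ <|
    have h : ∀ V : Set X.obj, V ∈ Set.range (toSet (preimageHom X.s)) → IsOpen V :=
      Set.forall_mem_range.2 X.isOpen_toSet_preimageHom_s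
    fun c => h _ (hrange.ge ⟨c, rfl⟩)

/-- The morphism `((βf)^*, f⁻¹)` of maximal de Vries extensions given by a continuous map `f`. -/
noncomputable def extensionMap {X Y : CReg.{u}} (f : X ⟶ Y) : Y.extension ⟶ X.extension :=
  ObjectProperty.homMk
    { ρ := deVriesDual.map (beta.map f).op
      σ := tarskiDual.map (points.map f).op
      comm := fun U => by
        have h : deVriesDual.map (beta.map f).op ≫ preimageHom X.s = preimageHom (Y.s ∘ f) := by
          rw [map_comp_preimageHom, beta_map_comp_s]
        exact (congrArg (fn · U) h).symm }

/-- The contravariant functor from completely regular spaces to maximal de Vries extensions. -/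
noncomputable def toMDeVe : CReg.{u}ᵒᵖ ⥤ MDeVe.{u} where
  obj X := X.unop.extension
  map f := extensionMap f.unop
  map_id X := MDeVe.topFunctor.map_injective ((points.op ⋙ tarskiDual).map_id X)
  map_comp f g := MDeVe.topFunctor.map_injective ((points.op ⋙ tarskiDual).map_comp f g)

instance : points.{u}.Faithful :=
  inferInstanceAs (ObjectProperty.ι _ ⋙ forget TopCat.{u}).Faithful

instance : toMDeVe.{u}.Faithful :=
  have : (toMDeVe.{u} ⋙ MDeVe.topFunctor).Faithful :=
    inferInstanceAs (points.op ⋙ tarskiDual).Faithful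
  Functor.Faithful.of_comp toMDeVe MDeVe.topFunctor

instance : toMDeVe.{u}.Full where
  map_surjective {Y X} k := by
    obtain ⟨f, hf⟩ := CABA.exists_setPreimage_eq (X := X.unop.obj) (Y := Y.unop.obj) k.hom.σ
    have hρ : k.hom.ρ ≫ preimageHom X.unop.s = preimageHom (Y.unop.s ∘ f) :=
      powerset_hom_ext fun U => (k.hom.comm U).symm.trans (DFunLike.congr_fun hf _).symm
    have hc : Continuous f := by
      rw [Y.unop.isDenseEmbedding_s.isInducing.continuous_iff,
        continuous_iff_isOpen_toSet_preimageHom, ← hρ]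
      exact isOpen_toSet_comp _ X.unop.isOpen_toSet_preimageHom_s
    let g : X.unop ⟶ Y.unop := ObjectProperty.homMk (TopCat.ofHom ⟨f, hc⟩)
    exact ⟨g.op, MDeVe.topFunctor.map_injective hf⟩

theorem exists_extension_iso (E : MDeVe.{u}) : ∃ X : CReg.{u}, Nonempty (E ≅ X.extension) := by
  let T := {a : E.obj.top // IsAtom a}
  let e : E.obj.top ≅ tarskiDual.obj (op T) := E.obj.top.atomsPowersetIso
  let φ : E.obj.base ⟶ powerset T := E.obj.map ≫ CABA.toDeVHom e.hom
  have hφ : IsDeVriesExtension (B := tarskiDual.obj (op T)) φ := E.obj.isExt.comp_iso e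
  let : TopologicalSpace T := .induced (pointOf φ) inferInstance
  have hd : IsDenseInducing (pointOf φ) := ⟨⟨rfl⟩, denseRange_pointOf hφ.injective⟩
  have hemb : Topology.IsEmbedding (pointOf φ) :=
    ⟨⟨rfl⟩, joinMeetDense_iff_injective_pointOf.1 hφ.dense⟩
  have : T35Space T := hemb.t35Space
  let X : CReg.{u} := ⟨TopCat.of T, this⟩
  refine ⟨X, MDeVe.nonempty_iso_of_image_range_eq (E' := X.extension) e ?_⟩
  ext (V : Set T)
  calc V ∈ CABA.fn e.hom '' Set.range E.obj.fn
      ↔ ∃ a, toSet φ a = V := by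
        rw [← Set.range_comp]
        exact exists_congr fun a => by rw [Function.comp_apply, ← CABA.comp_toDeVHom_apply]; rfl
    _ ↔ ∃ U : RegularOpen (Point E.obj.base), pointOf φ ⁻¹' U.pts = V :=
        ((Point.regularOpenIso _).surjective.exists (p := fun U => pointOf φ ⁻¹' U.pts = V)).symm
    _ ↔ interior (closure V) = V := RegularOpen.exists_preimage_pts_eq_iff hd
    _ ↔ ∃ U : RegularOpen (beta.obj X), X.s ⁻¹' U.pts = V :=
        (RegularOpen.exists_preimage_pts_eq_iff X.isDenseEmbedding_s.isDenseInducing).symm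

instance : toMDeVe.{u}.EssSurj where
  mem_essImage E :=
    let ⟨X, ⟨k⟩⟩ := exists_extension_iso E
    ⟨op X, ⟨k.symm⟩⟩

instance : toMDeVe.{u}.IsEquivalence where

end CReg

/-! ## Compact spaces and discrete spaces -/

namespace MDeVe

/-- An extension `α : A → B`, as a morphism `(α, id)` to the identity extension of `(B, ≤)`. -/
def toIdExtension (E : MDeVe.{u}) : E ⟶ E.obj.top.idExtension :=
  ObjectProperty.homMk
    { ρ := E.obj.map
      σ := 𝟙 E.obj.top
      comm := fun a => congrArg (DeV.fn · a) (Category.comp_id E.obj.map).symm }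

theorem toIdExtension_naturality {E E' : MDeVe.{u}} (f : E ⟶ E') :
    f ≫ E'.toIdExtension = E.toIdExtension ≫ CABA.toMDeVe.map (topFunctor.map f) :=
  topFunctor.map_injective ((Category.comp_id _).trans (Category.id_comp _).symm)

instance isIso_toIdExtension (E : MDeVe.{u}) [IsIso E.obj.map] : IsIso E.toIdExtension :=
  let g : E.obj.top.idExtension ⟶ E := ObjectProperty.homMk
    { ρ := inv (Y := E.obj.top.toDeV) E.obj.map
      σ := 𝟙 E.obj.top
      comm := fun a => congrArg (DeV.fn · a) (IsIso.inv_hom_id E.obj.map).symm }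
  ⟨g, topFunctor.map_injective (Category.id_comp _), topFunctor.map_injective (Category.id_comp _)⟩

end MDeVe

namespace CReg

open DeV

theorem isIso_preimageHom_s (X : CReg.{u}) [DiscreteTopology X.obj] :
    IsIso (preimageHom X.s) := by
  obtain ⟨δ, hδ⟩ := X.exists_comp_preimageHom_s_eq (𝟙 (powerset X.obj)) fun _ => isOpen_discrete _
  have : Mono (preimageHom X.s) := X.isDeVriesExtension_preimageHom_s.mono
  have : IsSplitEpi (preimageHom X.s) := ⟨⟨⟨δ, hδ⟩⟩⟩
  exact isIso_of_mono_of_isSplitEpi _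

instance (S : Type u) : IsIso (ofSet.obj S).extension.toIdExtension :=
  have : DiscreteTopology (ofSet.obj S).obj := ⟨rfl⟩
  have : IsIso (ofSet.obj S).extension.obj.map := (ofSet.obj S).isIso_preimageHom_s
  MDeVe.isIso_toIdExtension _

/-- On discrete spaces, the duality restricts to Tarski duality. -/
noncomputable def ofSetToMDeVeIso : ofSet.{u}.op ⋙ toMDeVe ≅ tarskiDual ⋙ CABA.toMDeVe :=
  NatIso.ofComponents (fun S => (asIso (ofSet.obj S.unop).extension.toIdExtension :))
    fun f => MDeVe.toIdExtension_naturality (toMDeVe.map (ofSet.map f.unop).op)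

instance : ofCompHaus.{u}.Faithful where
  map_injective h := compHausToTop.map_injective (congrArg (fun k => k.hom) h)

instance : ofCompHaus.{u}.Full where
  map_surjective f :=
    let ⟨g, hg⟩ := compHausToTop.map_surjective f.hom
    ⟨g, ObjectProperty.hom_ext _ hg⟩

/-- The Stone–Čech compactification of a compact Hausdorff space is the space itself. -/
noncomputable def ofCompHausBeta : ofCompHaus.{u} ⋙ beta ≅ 𝟭 CompHaus.{u} :=
  show compHausToTop.{u} ⋙ reflector compHausToTop.{u} ≅ 𝟭 CompHaus.{u} from
    asIso (reflectorAdjunction compHausToTop.{u}).counit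

/-- The embedding of de Vries algebras into maximal de Vries extensions: the space of points,
regarded as a completely regular space. -/
noncomputable def ofDeV : DeV.{u} ⥤ MDeVe.{u} :=
  deVriesDual.asEquivalence.inverse ⋙ ofCompHaus.op ⋙ toMDeVe

instance : ofDeV.{u}.Full :=
  inferInstanceAs (deVriesDual.asEquivalence.inverse ⋙ ofCompHaus.op ⋙ toMDeVe).Full

instance : ofDeV.{u}.Faithful :=
  inferInstanceAs (deVriesDual.asEquivalence.inverse ⋙ ofCompHaus.op ⋙ toMDeVe).Faithful

/-- The domain of the maximal extension given by a de Vries algebra is that algebra. -/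
noncomputable def ofDeVBaseIso : ofDeV.{u} ⋙ MDeVe.baseFunctor ≅ 𝟭 DeV.{u} :=
  Functor.isoWhiskerLeft deVriesDual.asEquivalence.inverse
    (Functor.isoWhiskerRight (NatIso.op ofCompHausBeta.symm) deVriesDual) ≪≫
    deVriesDual.asEquivalence.counitIso

/-- On compact Hausdorff spaces, the duality restricts to de Vries duality. -/
noncomputable def ofCompHausToMDeVeIso : ofCompHaus.{u}.op ⋙ toMDeVe ≅ deVriesDual ⋙ ofDeV :=
  Functor.isoWhiskerRight deVriesDual.asEquivalence.unitIso (ofCompHaus.op ⋙ toMDeVe)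

end CReg

theorem theorem6p7 :
    ∃ F : CReg.{u}ᵒᵖ ⥤ MDeVe.{u},
      -- `F` is a dual equivalence,
      F.IsEquivalence ∧
      -- which sends `X` to `s⁻¹ : RO(βX) → ℘(X)` and `f` to `((βf)^*, f⁻¹)`;
      (∃ (i : F ⋙ MDeVe.baseFunctor ≅ CReg.beta.op ⋙ deVriesDual)
        (j : F ⋙ MDeVe.topFunctor ≅ CReg.points.op ⋙ tarskiDual),
        ∀ (X : CReg.{u}) (a : (F.obj (op X)).obj.base),
          CABA.fn (j.hom.app (op X)) ((F.obj (op X)).obj.fn a) =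
            X.pullbackS (DeV.fn (i.hom.app (op X)) a)) ∧
      -- it extends de Vries duality between compact Hausdorff spaces and de Vries algebras,
      (deVriesDual.{u}.IsEquivalence ∧
        ∃ J : DeV.{u} ⥤ MDeVe.{u}, J.Full ∧ J.Faithful ∧
          Nonempty (J ⋙ MDeVe.baseFunctor ≅ 𝟭 DeV.{u}) ∧
          Nonempty (CReg.ofCompHaus.op ⋙ F ≅ deVriesDual ⋙ J)) ∧
      -- and Tarski duality between sets and complete atomic Boolean algebras.
      (tarskiDual.{u}.IsEquivalence ∧
        CABA.toMDeVe.{u}.Full ∧ CABA.toMDeVe.{u}.Faithful ∧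
        Nonempty (CReg.ofSet.op ⋙ F ≅ tarskiDual ⋙ CABA.toMDeVe)) := by
  exact ⟨CReg.toMDeVe, inferInstance, ⟨Iso.refl _, Iso.refl _, fun _ _ => rfl⟩,
    ⟨inferInstance, CReg.ofDeV, inferInstance, inferInstance, ⟨CReg.ofDeVBaseIso⟩,
      ⟨CReg.ofCompHausToMDeVeIso⟩⟩,
    inferInstance, inferInstance, inferInstance, ⟨CReg.ofSetToMDeVeIso⟩⟩
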